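/- For integers $m,n\ge 3$, a \emph{dicyclic graph} $[m,n]$ is a simple graph composed of an $m$-cycle and an $n$-cycle (on disjoint node sets) linked by a single edge; it has exactly two nodes of degree $3$, the endpoints of the linking edge. It is \emph{symmetric} if $m=n$. Consider message-passing GNNs with layers $t=0,1,\dots,L$ of the form $$h_v^{(t+1)}=\sigma\Big(W^{(t)}_{\mathrm{upd}}h_v^{(t)}+W^{(t)}_{\mathrm{agg}}\sum_{u\in\mathcal N_v}h_u^{(t)}+b^{(t)}\Big),\qquad h_v^{(0)}=\alpha_v\in\mathbb R^k,$$ where $\mathcal N_v$ is the set of neighbours of $v$, $\sigma$ is the ReLU activation $x\mapsto\max(x,0)$ applied element-wise, $W^{(0)}_{\mathrm{upd}},W^{(0)}_{\mathrm{agg}}\in\mathbb R^{h\times k}$, $W^{(t)}_{\mathrm{upd}},W^{(t)}_{\mathrm{agg}}\in\mathbb R^{h\times h}$ for $t\ge 1$, and $b^{(t)}\in\mathbb R^h$. Let READOUT be the function of the graph and its final hidden states $h^{(L+1)}$ that equals $1$ if the nodes of degree $3$ have the same hidden state and $0$ otherwise. Then GNNs of this form can classify symmetric dicyclic graphs, with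 a number of layers governed by the maximal cycle length. More precisely, for every feature dimension $k\in\mathbb N$ there are a hidden dimension $h$ and a sequence of parameters $(W^{(t)}_{\mathrm{upd}},W^{(t)}_{\mathrm{agg}},b^{(t)})_{t\ge 0}$ such that, for every $L\in\mathbb N$, the GNN with the layers $0,\dots,L$ of this sequence, followed by READOUT, outputs $1$ if $m=n$ and $0$ if $m\ne n$ on every dicyclic graph $[m,n]$ with $3\le m,n\le L$ and with uniform node features ($\alpha_v=c$ for all nodes $v$), for every $c\in\mathbb R^k$. -/

import Mathlib

open scoped Matrix

/-- The standard dicyclic graph: an `m`-cycle on the vertices `Sum.inl i` and an `n`-cycle on the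
vertices `Sum.inr j`, linked by the single edge between vertex `0` of the first cycle and vertex
`0` of the second. (It is meant for `3 ≤ m` and `3 ≤ n`, where both parts really are cycles.) -/
def dicyclicGraph (m n : ℕ) : SimpleGraph (Fin m ⊕ Fin n) where
  Adj
    | Sum.inl i, Sum.inl j => (SimpleGraph.cycleGraph m).Adj i j
    | Sum.inr i, Sum.inr j => (SimpleGraph.cycleGraph n).Adj i j
    | Sum.inl i, Sum.inr j => i.val = 0 ∧ j.val = 0
    | Sum.inr j, Sum.inl i => i.val = 0 ∧ j.val = 0
  symm := ⟨by
    rintro (i | i) (j | j) hij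
    · exact SimpleGraph.Adj.symm hij
    · exact hij
    · exact hij
    · exact SimpleGraph.Adj.symm hij⟩
  loopless := ⟨by
    rintro (i | i) hi
    · exact SimpleGraph.irrefl _ hi
    · exact SimpleGraph.irrefl _ hi⟩

/-- `G` is a dicyclic graph `[m, n]`: it consists of an `m`-cycle and an `n`-cycle
(`m, n ≥ 3`) linked by a single edge. The graph is symmetric when `m = n`. -/
def IsDicyclic {V : Type*} (G : SimpleGraph V) (m n : ℕ) : Prop :=
  3 ≤ m ∧ 3 ≤ n ∧ Nonempty (G ≃g dicyclicGraph m n)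

/-- The learnable parameters of one layer with input dimension `d` and output dimension `h`. -/
structure LayerParams (d h : ℕ) where
  /-- the matrix acting on the state of the node itself -/
  Wupd : Matrix (Fin h) (Fin d) ℝ
  /-- the matrix acting on the pooled states of the neighbours -/
  Wagg : Matrix (Fin h) (Fin d) ℝ
  /-- the bias -/
  b : Fin h → ℝ

/-- The learnable parameters of a graph neural network with feature dimension `k` and hidden
dimension `h`: an input layer (layer `0`), and layers `1, 2, …` (layer `t + 1` is `layer t`).
A network with layers `0, …, L` only uses the first `L` entries of `layer`. -/
structure GNNParams (k h : ℕ) where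
  /-- layer `0`, from feature dimension `k` to hidden dimension `h` -/
  input : LayerParams k h
  /-- layers `1, 2, …` -/
  layer : ℕ → LayerParams h h

/-- An aggregating operator, turning a multiset of vectors into a vector, in every dimension. -/
abbrev Pooling : Type := (d : ℕ) → Multiset (Fin d → ℝ) → (Fin d → ℝ)

/-- Sum pooling. -/
def sumPool : Pooling := fun _ s => s.sum

/-- The rectified linear unit. -/
noncomputable def relu (x : ℝ) : ℝ := max x 0

section GNN

variable {V : Type*} [Fintype V] (G : SimpleGraph V) [DecidableRel G.Adj]

/-- One message passing step
`x_v ↦ σ (Wupd x_v + Wagg POOL {{x_u | u ∈ N_v}} + b)`, with `σ` applied element-wise. -/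
def messagePassing (σ : ℝ → ℝ) (pool : Pooling) {d h : ℕ} (P : LayerParams d h)
    (x : V → Fin d → ℝ) : V → Fin h → ℝ :=
  fun v i => σ ((P.Wupd *ᵥ x v + P.Wagg *ᵥ pool d ((G.neighborFinset v).val.map x) + P.b) i)

/-- The hidden states computed by the layers `0, …, L` from the node features `α`. -/
def hiddenState (σ : ℝ → ℝ) (pool : Pooling) {k h : ℕ} (Θ : GNNParams k h)
    (α : V → Fin k → ℝ) : ℕ → V → Fin h → ℝ
  | 0 => messagePassing G σ pool Θ.input α
  | L + 1 => messagePassing G σ pool (Θ.layer L) (hiddenState σ pool Θ α L)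

open Classical in
/-- The READOUT: it outputs `1` if the nodes of degree three have the same hidden state,
and `0` otherwise. -/
noncomputable def degreeThreeReadout {h : ℕ} (x : V → Fin h → ℝ) : ℝ :=
  if ∀ u v : V, G.degree u = 3 → G.degree v = 3 → x u = x v then 1 else 0

end GNN

/-! The network has hidden dimension one, sets every state to `1` and then iterates
`x_v ↦ θ x_v + ∑ u ∈ N_v, x_u`, so after layer `L` the state of `v` is
`∑ i, (L choose i) w_i(v) θ ^ (L - i)`, where `w_i(v)` counts the walks of length `i` from `v`.
For transcendental `θ ≥ 0` this real number determines all of `w_0(v), …, w_L(v)`.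

On the cycle through an end `z` of the linking edge, add up the walk counts of the two nodes
reached from `z` by `i` steps in either direction. For `i` between `0` and the length of the cycle
these sums satisfy the recurrence of a path, so the walk counts of the two ends of the link
determine them for all `i`. If the two ends have the same walk counts, then so do their sums at
distance `i = m`, the length of the shorter cycle. There the two nodes are both equal to `z` on the
shorter cycle, but both of degree two on the longer one, and the degree sums `3 + 3` and `2 + 2`
differ. -/

section BinomialTransform

open Finset Polynomial

variable {R S : Type*}

/-- The binomial transform `∑ i, (L choose i) a_i θ ^ (L - i)` of the sequence `a`, with parameter
`θ`. It describes the iteration of `θ + A` in terms of that of `A`. -/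
def binomialTransform [Semiring R] (θ : R) (a : ℕ → ℕ) (L : ℕ) : R :=
  ∑ p ∈ antidiagonal L, (L.choose p.1 : R) * (a p.1 * θ ^ p.2)

lemma binomialTransform_zero [Semiring R] (θ : R) (a : ℕ → ℕ) :
    binomialTransform θ a 0 = a 0 := by
  simp [binomialTransform]

lemma binomialTransform_succ [Semiring R] (θ : R) (a : ℕ → ℕ) (L : ℕ) :
    binomialTransform θ a (L + 1) =
      θ * binomialTransform θ a L + binomialTransform θ (fun i => a (i + 1)) L := by
  rw [binomialTransform, sum_antidiagonal_choose_succ_mul fun i j => (a i : R) * θ ^ j,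
    binomialTransform, mul_sum]
  congr 1
  · refine sum_congr rfl fun p _ => ?_
    rw [pow_succ', (Nat.cast_commute _ θ).left_comm, (Nat.cast_commute _ θ).left_comm]
  · refine sum_congr rfl fun p hp => ?_
    rw [Nat.choose_symm_of_eq_add (mem_antidiagonal.1 hp).symm]

lemma binomialTransform_sum [Semiring R] {ι : Type*} (s : Finset ι) (θ : R) (a : ι → ℕ → ℕ)
    (L : ℕ) :
    binomialTransform θ (fun i => ∑ u ∈ s, a u i) L = ∑ u ∈ s, binomialTransform θ (a u) L := by
  simp only [binomialTransform, Nat.cast_sum, sum_mul, mul_sum]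
  exact sum_comm

lemma binomialTransform_nonneg [Semiring R] [PartialOrder R] [IsOrderedRing R] {θ : R}
    (hθ : 0 ≤ θ) (a : ℕ → ℕ) (L : ℕ) : 0 ≤ binomialTransform θ a L :=
  sum_nonneg fun _ _ => by positivity

lemma map_binomialTransform [Semiring R] [Semiring S] (φ : R →+* S) (θ : R) (a : ℕ → ℕ) (L : ℕ) :
    φ (binomialTransform θ a L) = binomialTransform (φ θ) a L := by
  simp [binomialTransform]

lemma coeff_binomialTransform_X [Semiring R] (a : ℕ → ℕ) (i j : ℕ) :
    (binomialTransform (X : R[X]) a (i + j)).coeff j = (i + j).choose i * a i := by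
  rw [binomialTransform, finsetSum_coeff, sum_eq_single (i, j)]
  · simp
  · rintro ⟨k, l⟩ hp hne
    have hl : j ≠ l := by
      rintro rfl
      exact hne (by simpa using hp)
    simp [hl]
  · simp

lemma binomialTransform_inj_of_transcendental [Ring R] {θ : R} (hθ : Transcendental ℤ θ)
    {a b : ℕ → ℕ} {L : ℕ} :
    binomialTransform θ a L = binomialTransform θ b L ↔ ∀ i ≤ L, a i = b i := by
  constructor
  · intro h i hi
    obtain ⟨j, rfl⟩ := Nat.exists_eq_add_of_le hi
    have aeval_X (c : ℕ → ℕ) :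
        aeval θ (binomialTransform (X : ℤ[X]) c (i + j)) = binomialTransform θ c (i + j) := by
      simpa using map_binomialTransform (aeval θ : ℤ[X] →ₐ[ℤ] R).toRingHom X c (i + j)
    have hX : binomialTransform (X : ℤ[X]) a (i + j) = binomialTransform X b (i + j) :=
      transcendental_iff_injective.1 hθ (by rw [aeval_X, aeval_X, h])
    have hcoeff := congrArg (coeff · j) hX
    simp only [coeff_binomialTransform_X] at hcoeff
    have hchoose : (i + j).choose i ≠ 0 := (Nat.choose_pos hi).ne'
    exact_mod_cast mul_left_cancel₀ (Nat.cast_ne_zero.2 hchoose) hcoeff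
  · intro h
    refine sum_congr rfl fun p hp => ?_
    have hle : p.1 ≤ L := (Nat.le_add_right _ _).trans_eq (mem_antidiagonal.1 hp)
    rw [h p.1 hle]

end BinomialTransform

section WalkCount

variable {V W : Type*} [Fintype V] [Fintype W] (G : SimpleGraph V) [DecidableRel G.Adj]
  {H : SimpleGraph W} [DecidableRel H.Adj]

/-- The number of walks of length `t` in `G` that start at a given vertex. -/
def walkCount : ℕ → V → ℕ
  | 0, _ => 1
  | t + 1, v => ∑ u ∈ G.neighborFinset v, walkCount t u

lemma walkCount_one (v : V) : walkCount G 1 v = G.degree v := by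
  simp [walkCount]

variable {G} in
lemma walkCount_iso_apply (e : G ≃g H) (t : ℕ) (v : V) :
    walkCount H t (e v) = walkCount G t v := by
  induction t generalizing v with
  | zero => rfl
  | succ t ih =>
    exact (Finset.sum_equiv e.toEquiv (by simp [e.map_adj_iff]) fun u _ => (ih u).symm).symm

/-- The network that replaces all features by `1` and then iterates
`x_v ↦ θ x_v + ∑ u ∈ N_v, x_u`. -/
def lazyWalkParams (k : ℕ) (θ : ℝ) : GNNParams k 1 where
  input := ⟨0, 0, 1⟩
  layer _ := ⟨θ • 1, 1, 0⟩

lemma hiddenState_lazyWalkParams {k : ℕ} {θ : ℝ} (hθ : 0 ≤ θ) (α : V → Fin k → ℝ) (L : ℕ) :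
    hiddenState G relu sumPool (lazyWalkParams k θ) α L =
      fun v _ => binomialTransform θ (walkCount G · v) L := by
  induction L with
  | zero =>
    ext v i
    simp [hiddenState, messagePassing, lazyWalkParams, relu, binomialTransform_zero, walkCount]
  | succ L ih =>
    ext v i
    have step : binomialTransform θ (walkCount G · v) (L + 1) =
        θ * binomialTransform θ (walkCount G · v) L +
          ∑ u ∈ G.neighborFinset v, binomialTransform θ (walkCount G · u) L := by
      rw [binomialTransform_succ, ← binomialTransform_sum]
      rfl
    have pool : ((G.neighborFinset v).val.map
        fun u (_ : Fin 1) => binomialTransform θ (walkCount G · u) L).sum i =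
          ∑ u ∈ G.neighborFinset v, binomialTransform θ (walkCount G · u) L :=
      Finset.sum_apply i _ _
    have nonneg := binomialTransform_nonneg hθ (walkCount G · v) (L + 1)
    rw [hiddenState, ih]
    simp only [messagePassing, lazyWalkParams, sumPool, relu, Matrix.smul_mulVec, Matrix.one_mulVec,
      Pi.add_apply, Pi.smul_apply, Pi.zero_apply, smul_eq_mul, pool, ← step, add_zero,
      max_eq_left nonneg]

lemma hiddenState_lazyWalkParams_eq_iff {k : ℕ} {θ : ℝ} (hθ : 0 ≤ θ) (hθ' : Transcendental ℤ θ)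
    (α : V → Fin k → ℝ) (L : ℕ) (u v : V) :
    hiddenState G relu sumPool (lazyWalkParams k θ) α L u =
        hiddenState G relu sumPool (lazyWalkParams k θ) α L v ↔
      ∀ t ≤ L, walkCount G t u = walkCount G t v := by
  rw [hiddenState_lazyWalkParams G hθ, funext_iff, forall_const,
    binomialTransform_inj_of_transcendental hθ']

end WalkCount

/-- Solved for its last term, the recurrence propagates the boundary values at `0` and `1` inwards,
at the cost of one time step per position. -/
lemma eq_of_path_recurrence {M : Type*} [Add M] [IsLeftCancelAdd M] {s r : ℕ → ℕ → M} {l T : ℕ}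
    (hs : ∀ t i, i + 1 < l → s (t + 1) (i + 1) = s t i + s t (i + 2))
    (hr : ∀ t i, i + 1 < l → r (t + 1) (i + 1) = r t i + r t (i + 2))
    (h0 : ∀ t ≤ T, s t 0 = r t 0) (h1 : ∀ t < T, s t 1 = r t 1) {i t : ℕ} (hi : i ≤ l)
    (ht : t + i ≤ T) : s t i = r t i := by
  induction i using Nat.twoStepInduction generalizing t with
  | zero => exact h0 t ht
  | one => exact h1 t ht
  | more i ih ih_succ =>
    have h := ih_succ (t := t + 1) (by omega) (by omega)
    rw [hs t i hi, hr t i hi, ih (by omega) (by omega)] at h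
    exact add_left_cancel h

section Dicyclic

instance (m n : ℕ) : DecidableRel (dicyclicGraph m n).Adj
  | .inl i, .inl j => inferInstanceAs (Decidable ((SimpleGraph.cycleGraph m).Adj i j))
  | .inl i, .inr j => inferInstanceAs (Decidable (i.val = 0 ∧ j.val = 0))
  | .inr j, .inl i => inferInstanceAs (Decidable (i.val = 0 ∧ j.val = 0))
  | .inr i, .inr j => inferInstanceAs (Decidable ((SimpleGraph.cycleGraph n).Adj i j))

/-- The isomorphism `[m, n] ≃ [n, m]` that exchanges the two cycles; it reduces every fact about
nodes of the second cycle to one about nodes of the first. -/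
def dicyclicGraphSwap (m n : ℕ) : dicyclicGraph m n ≃g dicyclicGraph n m where
  toEquiv := Equiv.sumComm _ _
  map_rel_iff' := by
    rintro (i | i) (j | j) <;> simp [dicyclicGraph, and_comm]

lemma walkCount_dicyclicGraph_inr (m n t : ℕ) (j : Fin n) :
    walkCount (dicyclicGraph m n) t (.inr j) = walkCount (dicyclicGraph n m) t (.inl j) :=
  walkCount_iso_apply (dicyclicGraphSwap n m) t (.inl j)

variable {m n : ℕ}

lemma neighborFinset_dicyclicGraph_inl (i : Fin (m + 3)) :
    (dicyclicGraph (m + 3) (n + 3)).neighborFinset (.inl i) =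
      ({i - 1, i + 1} : Finset (Fin (m + 3))).disjSum (if i = 0 then {0} else ∅) := by
  ext (j | j)
  · rw [SimpleGraph.mem_neighborFinset]
    have cycle : (SimpleGraph.cycleGraph (m + 3)).Adj i j ↔ j ∈ ({i - 1, i + 1} : Finset _) := by
      rw [← SimpleGraph.cycleGraph_neighborFinset, SimpleGraph.mem_neighborFinset]
    simpa [dicyclicGraph] using cycle
  · rw [SimpleGraph.mem_neighborFinset]
    by_cases hi : i = 0 <;> simp [dicyclicGraph, hi]

lemma sum_neighborFinset_dicyclicGraph_inl {M : Type*} [AddCommMonoid M]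
    (x : Fin (m + 3) ⊕ Fin (n + 3) → M) (i : Fin (m + 3)) :
    ∑ u ∈ (dicyclicGraph (m + 3) (n + 3)).neighborFinset (.inl i), x u =
      x (.inl (i - 1)) + x (.inl (i + 1)) + if i = 0 then x (.inr 0) else 0 := by
  have two_neighbors : i - 1 ≠ i + 1 := by
    rw [← Finset.card_pair_eq_two_iff, ← SimpleGraph.cycleGraph_degree_two_le,
      SimpleGraph.cycleGraph_degree_three_le]
  rw [neighborFinset_dicyclicGraph_inl, Finset.sum_disjSum,
    Finset.sum_pair two_neighbors]
  split_ifs <;> simp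

lemma degree_dicyclicGraph_inl (i : Fin (m + 3)) :
    (dicyclicGraph (m + 3) (n + 3)).degree (.inl i) = if i = 0 then 3 else 2 := by
  rw [← SimpleGraph.card_neighborFinset_eq_degree, Finset.card_eq_sum_ones,
    sum_neighborFinset_dicyclicGraph_inl]
  split_ifs <;> rfl

lemma degree_dicyclicGraph_eq_three_iff (v : Fin (m + 3) ⊕ Fin (n + 3)) :
    (dicyclicGraph (m + 3) (n + 3)).degree v = 3 ↔ v = .inl 0 ∨ v = .inr 0 := by
  rcases v with i | j
  · simp [degree_dicyclicGraph_inl]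
  · rw [← (dicyclicGraphSwap _ _).degree_eq]
    change (dicyclicGraph _ _).degree (.inl j) = 3 ↔ _
    simp [degree_dicyclicGraph_inl]

lemma forall_degree_eq_three_iff {V : Type*} [Fintype V] {G : SimpleGraph V} [DecidableRel G.Adj]
    (e : G ≃g dicyclicGraph (m + 3) (n + 3)) {α : Type*} (x : V → α) :
    (∀ u v : V, G.degree u = 3 → G.degree v = 3 → x u = x v) ↔
      x (e.symm (.inl 0)) = x (e.symm (.inr 0)) := by
  simp_rw [e.symm.surjective.forall, e.symm.degree_eq, degree_dicyclicGraph_eq_three_iff]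
  constructor
  · exact fun h => h _ _ (.inl rfl) (.inr rfl)
  · rintro h _ _ (rfl | rfl) (rfl | rfl) <;> simp [h]

open Fin.CommRing

lemma fin_natCast_ne_zero_of_lt {l i : ℕ} [NeZero l] (h0 : 0 < i) (hi : i < l) :
    (i : Fin l) ≠ 0 :=
  mt Fin.natCast_eq_zero.1 (Nat.not_dvd_of_pos_of_lt h0 hi)

/-- The number of walks of length `t` in `[m + 3, n + 3]` that start at one of the nodes `i` and
`-i` of the first cycle, counted twice if these coincide. -/
def mirrorWalkCount (m n t i : ℕ) : ℕ :=
  walkCount (dicyclicGraph (m + 3) (n + 3)) t (.inl i) +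
    walkCount (dicyclicGraph (m + 3) (n + 3)) t (.inl (-i))

lemma mirrorWalkCount_zero (m n t : ℕ) :
    mirrorWalkCount m n t 0 = 2 * walkCount (dicyclicGraph (m + 3) (n + 3)) t (.inl 0) := by
  simp [mirrorWalkCount, two_mul]

lemma walkCount_succ_inl_zero (m n t : ℕ) :
    walkCount (dicyclicGraph (m + 3) (n + 3)) (t + 1) (.inl 0) =
      mirrorWalkCount m n t 1 + walkCount (dicyclicGraph (n + 3) (m + 3)) t (.inl 0) := by
  rw [walkCount, sum_neighborFinset_dicyclicGraph_inl, if_pos rfl, walkCount_dicyclicGraph_inr,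
    mirrorWalkCount]
  simp [add_comm]

lemma mirrorWalkCount_succ_succ (t : ℕ) {i : ℕ} (hi : i + 1 < m + 3) :
    mirrorWalkCount m n (t + 1) (i + 1) =
      mirrorWalkCount m n t i + mirrorWalkCount m n t (i + 2) := by
  have h0 : ((i + 1 : ℕ) : Fin (m + 3)) ≠ 0 := fin_natCast_ne_zero_of_lt i.succ_pos hi
  have pred : ((i + 1 : ℕ) : Fin (m + 3)) - 1 = i := by push_cast; ring
  have succ : ((i + 1 : ℕ) : Fin (m + 3)) + 1 = (i + 2 : ℕ) := by push_cast; ring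
  have neg_pred : -((i + 1 : ℕ) : Fin (m + 3)) - 1 = -(i + 2 : ℕ) := by push_cast; ring
  have neg_succ : -((i + 1 : ℕ) : Fin (m + 3)) + 1 = -i := by push_cast; ring
  simp only [mirrorWalkCount, walkCount, sum_neighborFinset_dicyclicGraph_inl, if_neg h0,
    if_neg (neg_ne_zero.2 h0), pred, succ, neg_pred, neg_succ]
  ring

lemma mirrorWalkCount_one (i : ℕ) :
    mirrorWalkCount m n 1 i = if (i : Fin (m + 3)) = 0 then 6 else 4 := by
  simp only [mirrorWalkCount, walkCount_one, degree_dicyclicGraph_inl, neg_eq_zero]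
  split_ifs <;> rfl

lemma exists_walkCount_inl_zero_ne_of_lt (hmn : m < n) :
    ∃ t ≤ m + 4, walkCount (dicyclicGraph (m + 3) (n + 3)) t (.inl 0) ≠
      walkCount (dicyclicGraph (n + 3) (m + 3)) t (.inl 0) := by
  by_contra! h
  have boundary_one (t : ℕ) (ht : t < m + 4) :
      mirrorWalkCount m n t 1 = mirrorWalkCount n m t 1 := by
    have h_succ := h (t + 1) ht
    rw [walkCount_succ_inl_zero, walkCount_succ_inl_zero, h t ht.le] at h_succ
    exact add_right_cancel h_succ
  have degree_sums : mirrorWalkCount m n 1 (m + 3) = mirrorWalkCount n m 1 (m + 3) :=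
    eq_of_path_recurrence (l := m + 3) (T := m + 4)
      (fun t _ hi => mirrorWalkCount_succ_succ t hi)
      (fun t _ hi => mirrorWalkCount_succ_succ t (by omega))
      (fun t ht => by rw [mirrorWalkCount_zero, mirrorWalkCount_zero, h t ht])
      boundary_one le_rfl (by omega)
  rw [mirrorWalkCount_one, mirrorWalkCount_one, if_pos (Fin.natCast_self _),
    if_neg (fin_natCast_ne_zero_of_lt (by omega) (by omega))] at degree_sums
  omega

lemma forall_walkCount_inl_zero_eq_inr_zero_iff {L : ℕ} (hL : m ≠ n → min m n + 4 ≤ L) :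
    (∀ t ≤ L, walkCount (dicyclicGraph (m + 3) (n + 3)) t (.inl 0) =
      walkCount (dicyclicGraph (m + 3) (n + 3)) t (.inr 0)) ↔ m = n := by
  simp_rw [walkCount_dicyclicGraph_inr]
  constructor
  · intro h
    by_contra hmn
    rcases Nat.lt_or_gt_of_ne hmn with hlt | hlt
    · obtain ⟨t, ht, hne⟩ := exists_walkCount_inl_zero_ne_of_lt hlt
      exact hne (h t (by omega))
    · obtain ⟨t, ht, hne⟩ := exists_walkCount_inl_zero_ne_of_lt hlt
      exact hne (h t (by omega)).symm
  · rintro rfl _ _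
    rfl

end Dicyclic

theorem corollary1_general (k : ℕ) :
    ∃ Θ : GNNParams k 1,
      ∀ (L m n : ℕ), (m ≠ n → min m n < L) →
        ∀ (V : Type*) [Fintype V] (G : SimpleGraph V) [DecidableRel G.Adj], IsDicyclic G m n →
          ∀ α : V → Fin k → ℝ,
            degreeThreeReadout G (hiddenState G relu sumPool Θ α L) = if m = n then 1 else 0 := by
  have hθ : Transcendental ℤ (liouvilleNumber (2 : ℕ)) := transcendental_liouvilleNumber le_rfl
  have hθ0 : 0 ≤ liouvilleNumber (2 : ℕ) := tsum_nonneg fun i => by positivity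
  refine ⟨lazyWalkParams k (liouvilleNumber (2 : ℕ)), ?_⟩
  rintro L m n hL V _ G _ ⟨hm, hn, ⟨e⟩⟩ α
  obtain ⟨m, rfl⟩ := Nat.exists_eq_add_of_le' hm
  obtain ⟨n, rfl⟩ := Nat.exists_eq_add_of_le' hn
  refine if_congr ?_ rfl rfl
  rw [forall_degree_eq_three_iff e, hiddenState_lazyWalkParams_eq_iff G hθ0 hθ]
  simp_rw [walkCount_iso_apply e.symm]
  rw [forall_walkCount_inl_zero_eq_inr_zero_iff (by omega), Nat.add_right_cancel_iff]

theorem corollary1 (k : ℕ) :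
    ∃ (h : ℕ) (Θ : GNNParams k h),
      ∀ (L m n : ℕ), m ≤ L → n ≤ L →
        ∀ (V : Type*) [Fintype V] (G : SimpleGraph V) [DecidableRel G.Adj], IsDicyclic G m n →
          ∀ c : Fin k → ℝ,
            degreeThreeReadout G (hiddenState G relu sumPool Θ (fun _ => c) L) =
              if m = n then 1 else 0 := by
  obtain ⟨Θ, hΘ⟩ := corollary1_general k
  exact ⟨1, Θ, fun L m n hm hn V _ G _ hG c => hΘ L m n (by omega) V G hG fun _ => c⟩
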